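/- All simplicial complexes are finite and abstract; faces are nonempty, and the dimension of a face is its number of vertices minus one. A face of a complex is free if it is properly contained in exactly one other face (which then has dimension one more). A complex is non-evasive if it is a single point or, recursively, if it has a vertex whose link and whose deletion are both non-evasive. A $d$-complex is a $d$-dimensional simplicial complex. Theorem. Let $d \ge 1$. (i) There is a non-evasive $d$-complex $E_d$ with exactly two free faces $\sigma \ne \tau$; moreover $\sigma$ and $\tau$ are $(d-1)$-dimensional and share a face of codimension one, i.e. $\dim(\sigma\cap\tau) = d-2$ (for $d=1$ this is the empty face). (ii) The number two is optimal: every non-evasive $d$-complex has at least two free faces. -/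

import Mathlib

namespace PreAbstractSimplicialComplex

variable {V : Type*}

/-- `K` has dimension `d`: its largest faces have `d + 1` vertices. -/
def HasDimension (K : PreAbstractSimplicialComplex V) (d : ℕ) : Prop :=
  (∃ s ∈ K.faces, s.card = d + 1) ∧ ∀ s ∈ K.faces, s.card ≤ d + 1

/-- A (nonempty) face `σ` of `K` is free if exactly one face of `K` properly contains it.
As `K` is closed under passing to nonempty subsets, that face has dimension `dim σ + 1`. -/
def IsFreeFace (K : PreAbstractSimplicialComplex V) (σ : Finset V) : Prop :=
  σ ∈ K.faces ∧ ∃! τ : Finset V, τ ∈ K.faces ∧ σ ⊂ τ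

/-- The set of all free faces of `K`, of every dimension. -/
def freeFaces (K : PreAbstractSimplicialComplex V) : Set (Finset V) :=
  {σ | K.IsFreeFace σ}

/-- The deletion of the vertex `v`: all faces of `K` that do not contain `v`. -/
def deletion (K : PreAbstractSimplicialComplex V) (v : V) : PreAbstractSimplicialComplex V where
  faces := {s | s ∈ K.faces ∧ v ∉ s}
  isRelLowerSet_faces := by
    rintro s ⟨hs, hv⟩
    exact ⟨(K.isRelLowerSet_faces hs).1,
      fun t hts ht => ⟨(K.isRelLowerSet_faces hs).2 hts ht, fun h => hv (hts h)⟩⟩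

/-- The link of the vertex `v`: all nonempty `s` with `v ∉ s` such that `s ∪ {v}` is a face. -/
def link [DecidableEq V] (K : PreAbstractSimplicialComplex V) (v : V) :
    PreAbstractSimplicialComplex V where
  faces := {s | s.Nonempty ∧ v ∉ s ∧ insert v s ∈ K.faces}
  isRelLowerSet_faces := by
    rintro s ⟨hs, hv, hK⟩
    exact ⟨hs, fun t hts ht => ⟨ht, fun h => hv (hts h),
      (K.isRelLowerSet_faces hK).2 (Finset.insert_subset_insert v hts)
        (Finset.insert_nonempty v t)⟩⟩

/-- Non-evasive complexes: a single point is non-evasive, and a complex is non-evasive if it has a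
vertex whose link and deletion are both non-evasive. (Such a complex is automatically finite and
has at least one vertex.) -/
inductive NonEvasive [DecidableEq V] : PreAbstractSimplicialComplex V → Prop
  | point (K : PreAbstractSimplicialComplex V) (v : V) (hK : K.faces = {{v}}) : NonEvasive K
  | step (K : PreAbstractSimplicialComplex V) (v : V) (hv : {v} ∈ K.faces)
      (hlink : NonEvasive (K.link v)) (hdel : NonEvasive (K.deletion v)) : NonEvasive K

end PreAbstractSimplicialComplex

namespace PreAbstractSimplicialComplex

/-! ### Free faces, links, and the lower bound. -/

section General

variable {V : Type*} {K L D : PreAbstractSimplicialComplex V} {s t : Finset V}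

/-! Lower bound: induct on the derivation of non-evasiveness. If the link of `v` is not a point, it
has two free faces, and their cones with apex `v` are free in `K` (`isFreeFace_insert_iff`). If the
link is a point, `{v}` is free, and a second free face comes from the deletion, or from the other
endpoint when `K` is an edge.

Construction: the engine is `HasTwoFreeFaces.attach`, which glues to `D` the cone `v * L` over a
subcomplex `L` with two free faces `σ`, `τ`. If `L` contains every free face of `D` but no maximal
face of `D`, then each face of `L` lies both in a larger face of `D` and in its own cone. So the old
free faces disappear, and only `v * σ` and `v * τ` are free. Since both contain `v`, the codimension
of their intersection is preserved.

Such an `L` is a solution one dimension lower, so the induction carries nested solutions,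
`FreeFaceTower`. Given `E` with its subcomplex `G`, put `F = E ∪ b * G`. The free faces of `b * E`
lie in `E` or are cones over the free faces of `E`, which are in `G`; all of them lie in `F`. Hence
`K = b * E ∪ a * F` is a solution one dimension above `E`. The tower below `K` is found inside `a *
F` by `FreeFaceTower.exists_in_cone`. The induction starts from an explicit 2-complex, verified by
computation. -/

theorem nonempty_of_mem (hs : s ∈ K.faces) : s.Nonempty := (K.isRelLowerSet_faces hs).1

theorem mem_of_subset (hs : s ∈ K.faces) (hts : t ⊆ s) (ht : t.Nonempty) : t ∈ K.faces :=
  (K.isRelLowerSet_faces hs).2 hts ht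

/-- Every face of `L` is a face of `K` that is not maximal in `K`. -/
def NonmaxIn (L K : PreAbstractSimplicialComplex V) : Prop :=
  ∀ s ∈ L.faces, ∃ t ∈ K.faces, s ⊂ t

theorem NonmaxIn.subset (h : L.NonmaxIn K) : L.faces ⊆ K.faces := fun s hs => by
  obtain ⟨t, ht, hst⟩ := h s hs
  exact mem_of_subset ht hst.1 (nonempty_of_mem hs)

theorem NonmaxIn.mono (h : L.NonmaxIn K) (hK : K.faces ⊆ D.faces) : L.NonmaxIn D := fun s hs => by
  obtain ⟨t, ht, hst⟩ := h s hs
  exact ⟨t, hK ht, hst⟩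

/-- No face of `K` contains `v`. -/
def AvoidsVertex (K : PreAbstractSimplicialComplex V) (v : V) : Prop :=
  ∀ s ∈ K.faces, v ∉ s

theorem AvoidsVertex.mono {v : V} (h : K.AvoidsVertex v) (hL : L.faces ⊆ K.faces) :
    L.AvoidsVertex v := fun s hs => h s (hL hs)

theorem IsFreeFace.eq_of_ssubset {s t u : Finset V} (h : K.IsFreeFace s) (ht : t ∈ K.faces)
    (hst : s ⊂ t) (hu : u ∈ K.faces) (hsu : s ⊂ u) : t = u :=
  h.2.unique ⟨ht, hst⟩ ⟨hu, hsu⟩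

variable [DecidableEq V] {v : V}

theorem erase_mem_link (ht : t ∈ K.faces) (hv : v ∈ t) (hne : (t.erase v).Nonempty) :
    t.erase v ∈ (K.link v).faces :=
  ⟨hne, Finset.notMem_erase _ _, by rwa [Finset.insert_erase hv]⟩

theorem insert_inj_of_notMem (hs : v ∉ s) (ht : v ∉ t) (h : insert v s = insert v t) : s = t := by
  rw [← Finset.erase_insert hs, h, Finset.erase_insert ht]

theorem insert_ssubset_insert (hs : v ∉ s) (ht : v ∉ t) (h : s ⊂ t) : insert v s ⊂ insert v t :=
  (Finset.insert_subset_insert v h.1).ssubset_of_ne fun he => h.ne (insert_inj_of_notMem hs ht he)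

theorem ssubset_erase_of_insert_ssubset (hs : v ∉ s) (h : insert v s ⊂ t) : s ⊂ t.erase v := by
  refine Finset.ssubset_iff_subset_ne.2
    ⟨Finset.subset_erase.2 ⟨(Finset.subset_insert v s).trans h.1, hs⟩, fun he => h.ne ?_⟩
  rw [he, Finset.insert_erase (h.1 (Finset.mem_insert_self v s))]

theorem eq_singleton_of_erase_eq_empty (hv : v ∈ s) (h : s.erase v = ∅) : s = {v} := by
  rw [← Finset.insert_erase hv, h]
  rfl

theorem singleton_ssubset_insert (hs : s.Nonempty) (hv : v ∉ s) : {v} ⊂ insert v s := by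
  have := insert_ssubset_insert (Finset.notMem_empty v) hv (Finset.empty_ssubset.2 hs)
  rwa [insert_empty_eq] at this

/-- The free faces containing a vertex `v` and another vertex are the cones over the free faces
of the link of `v`. -/
theorem isFreeFace_insert_iff (hs : s.Nonempty) (hv : v ∉ s) :
    K.IsFreeFace (insert v s) ↔ (K.link v).IsFreeFace s := by
  constructor
  · rintro ⟨h1, t, ⟨ht, hst⟩, hu⟩
    have hvt : v ∈ t := hst.1 (Finset.mem_insert_self _ _)
    have hst' := ssubset_erase_of_insert_ssubset hv hst
    refine ⟨⟨hs, hv, h1⟩, t.erase v,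
      ⟨erase_mem_link ht hvt (hs.mono hst'.1), hst'⟩, ?_⟩
    rintro u ⟨⟨_, hvu, huK⟩, hsu⟩
    have := hu (insert v u) ⟨huK, insert_ssubset_insert hv hvu hsu⟩
    rw [← this, Finset.erase_insert hvu]
  · rintro ⟨⟨_, _, h1⟩, t, ⟨⟨htn, hvt, ht⟩, hst⟩, hu⟩
    refine ⟨h1, insert v t, ⟨ht, insert_ssubset_insert hv hvt hst⟩, ?_⟩
    rintro u ⟨huK, hsu⟩
    have hvu : v ∈ u := hsu.1 (Finset.mem_insert_self _ _)
    have hsu' := ssubset_erase_of_insert_ssubset hv hsu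
    have := hu (u.erase v) ⟨erase_mem_link huK hvu (hs.mono hsu'.1), hsu'⟩
    rw [← this, Finset.insert_erase hvu]

theorem NonEvasive.exists_support (h : K.NonEvasive) : ∃ S : Finset V, ∀ s ∈ K.faces, s ⊆ S := by
  induction h with
  | point K v hK => exact ⟨{v}, by simp [hK]⟩
  | step K v hv _ _ _ ih =>
    rename_i ih₁
    obtain ⟨S, hS⟩ := ih
    obtain ⟨T, hT⟩ := ih₁
    refine ⟨insert v (S ∪ T), fun s hs => ?_⟩
    by_cases hvs : v ∈ s
    · rcases (s.erase v).eq_empty_or_nonempty with he | hne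
      · simp [eq_singleton_of_erase_eq_empty hvs he]
      · have := hT _ (erase_mem_link hs hvs hne)
        grind
    · have := hS s ⟨hs, hvs⟩
      grind

/-- A non-evasive complex that is not a point has two free faces. -/
theorem NonEvasive.exists_free_pair (h : K.NonEvasive) :
    (∃ x, K.faces = {{x}}) ∨ ∃ σ τ, σ ≠ τ ∧ K.IsFreeFace σ ∧ K.IsFreeFace τ := by
  induction h with
  | point K v hK => exact .inl ⟨v, hK⟩
  | step K v hv _ _ ihl ihd =>
    right
    rcases ihl with ⟨x, hx⟩ | ⟨σ, τ, hne, hσ, hτ⟩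
    · obtain ⟨-, hvx, hvxK⟩ : {x} ∈ (K.link v).faces := by simp [hx]
      have hvx' : v ≠ x := by simpa using hvx
      have hxK : {x} ∈ K.faces := mem_of_subset hvxK (by simp) (by simp)
      have honly : ∀ t ∈ K.faces, v ∈ t → t = {v} ∨ t = {v, x} := fun t ht hvt => by
        rcases (t.erase v).eq_empty_or_nonempty with he | hn
        · exact .inl (eq_singleton_of_erase_eq_empty hvt he)
        · right
          have := erase_mem_link ht hvt hn
          rw [hx] at this
          rw [← Finset.insert_erase hvt, this]
      have hfv : K.IsFreeFace {v} := by
        refine ⟨hv, {v, x}, ⟨hvxK, singleton_ssubset_insert (by simp) hvx⟩, ?_⟩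
        · rintro t ⟨ht, hvt⟩
          rcases honly t ht (by simpa using hvt.1) with rfl | rfl
          · exact absurd rfl hvt.ne
          · rfl
      rcases ihd with ⟨y, hy⟩ | ⟨σ, τ, hne, hσ, hτ⟩
      · have hxy : x = y := by
          have : {x} ∈ (K.deletion v).faces := ⟨hxK, hvx⟩
          simpa [hy] using this
        subst hxy
        refine ⟨{v}, {x}, by simpa using hvx', hfv, hxK, {v, x}, ⟨hvxK, ?_⟩, ?_⟩
        · exact Finset.ssubset_insert hvx
        · rintro t ⟨ht, hxt⟩
          by_cases hvt : v ∈ t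
          · rcases honly t ht hvt with rfl | rfl
            · exact absurd (hxt.1 (Finset.mem_singleton_self x)) (by simpa using hvx'.symm)
            · rfl
          · have : t ∈ (K.deletion v).faces := ⟨ht, hvt⟩
            rw [hy] at this
            exact absurd this.symm hxt.ne
      -- At most one of the two free faces of the deletion is `{x}`. The other gains no coface in
      -- `K`, since the only faces through `v` are `{v}` and `{v, x}`.
      · obtain ⟨ρ, hρ, hρx⟩ : ∃ ρ, (K.deletion v).IsFreeFace ρ ∧ ρ ≠ {x} := by
          by_cases h : σ = {x}
          · exact ⟨τ, hτ, fun h' => hne (h.trans h'.symm)⟩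
          · exact ⟨σ, hσ, h⟩
        obtain ⟨⟨hρK, hvρ⟩, t, ⟨⟨ht, hvt⟩, hρt⟩, hu⟩ := hρ
        refine ⟨{v}, ρ, by grind, hfv, hρK, t, ⟨ht, hρt⟩, ?_⟩
        rintro u ⟨huK, hρu⟩
        refine hu u ⟨⟨huK, fun hvu => ?_⟩, hρu⟩
        obtain ⟨y, hy⟩ := nonempty_of_mem hρK
        rcases honly u huK hvu with rfl | rfl
        · have := hρu.1 hy
          grind
        · have : ρ ⊆ {x} := fun z hz => by
            have := hρu.1 hz
            grind
          grind
    · refine ⟨insert v σ, insert v τ, fun h => hne (insert_inj_of_notMem hσ.1.2.1 hτ.1.2.1 h), ?_, ?_⟩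
      · exact (isFreeFace_insert_iff hσ.1.1 hσ.1.2.1).2 hσ
      · exact (isFreeFace_insert_iff hτ.1.1 hτ.1.2.1).2 hτ

theorem NonEvasive.two_le_encard_freeFaces {d : ℕ} (hd : 1 ≤ d) (hK : K.HasDimension d)
    (h : K.NonEvasive) : 2 ≤ K.freeFaces.encard := by
  rcases h.exists_free_pair with ⟨x, hx⟩ | ⟨σ, τ, hne, hσ, hτ⟩
  · obtain ⟨⟨s, hs, hc⟩, -⟩ := hK
    rw [hx, Set.mem_singleton_iff] at hs
    subst hs
    simp at hc
    omega
  · rw [← Set.encard_pair hne]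
    exact Set.encard_le_encard (by rintro s (rfl | rfl) <;> assumption)

end General

/-! ### Attaching cones. -/

section Attach

variable {V : Type*} [DecidableEq V] {K L D : PreAbstractSimplicialComplex V} {s t : Finset V}
  {v : V}

/-- The union of `D` with the cone over `L` with apex `v`. -/
def attach (D : PreAbstractSimplicialComplex V) (v : V) (L : PreAbstractSimplicialComplex V) :
    PreAbstractSimplicialComplex V where
  -- The disjunct `s ∈ L.faces` is redundant when `L` is a subcomplex of `D`; it makes the family
  -- closed under subsets for arbitrary `L`.
  faces := {s | s ∈ D.faces ∨ s ∈ L.faces ∨ v ∈ s ∧ (s = {v} ∨ s.erase v ∈ L.faces)}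
  isRelLowerSet_faces := by
    rintro s (h | h | ⟨hv, h⟩)
    · exact ⟨nonempty_of_mem h, fun t hts ht => .inl (mem_of_subset h hts ht)⟩
    · exact ⟨nonempty_of_mem h, fun t hts ht => .inr (.inl (mem_of_subset h hts ht))⟩
    · refine ⟨⟨v, hv⟩, fun t hts ht => .inr ?_⟩
      rcases h with rfl | h
      · right
        have : t = {v} := (Finset.subset_singleton_iff.1 hts).resolve_left ht.ne_empty
        simp [this]
      · by_cases hvt : v ∈ t
        · right
          refine ⟨hvt, ?_⟩
          rcases (t.erase v).eq_empty_or_nonempty with he | hn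
          · exact .inl (eq_singleton_of_erase_eq_empty hvt he)
          · right
            exact mem_of_subset h (Finset.erase_subset_erase v hts) hn
        · left
          refine mem_of_subset h (fun x hx => ?_) ht
          grind

theorem mem_attach_left (hs : s ∈ D.faces) : s ∈ (D.attach v L).faces := .inl hs

theorem apex_mem_attach : {v} ∈ (D.attach v L).faces := .inr (.inr ⟨by simp, .inl rfl⟩)

theorem insert_mem_attach (hv : v ∉ s) (hs : s ∈ L.faces) : insert v s ∈ (D.attach v L).faces :=
  .inr (.inr ⟨by simp, .inr (by rwa [Finset.erase_insert hv])⟩)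

theorem mem_attach_cases (hL : L.faces ⊆ D.faces) (hs : s ∈ (D.attach v L).faces) :
    s ∈ D.faces ∨ s = {v} ∨ ∃ t ∈ L.faces, s = insert v t := by
  rcases hs with h | h | ⟨hv, h | h⟩
  · exact .inl h
  · exact .inl (hL h)
  · exact .inr (.inl h)
  · exact .inr (.inr ⟨_, h, (Finset.insert_erase hv).symm⟩)

theorem link_attach (hD : D.AvoidsVertex v) (hL : L.AvoidsVertex v) : (D.attach v L).link v = L := by
  ext s
  constructor
  · rintro ⟨hn, hv, h | h | ⟨-, h | h⟩⟩
    · exact absurd (Finset.mem_insert_self v s) (hD _ h)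
    · exact absurd (Finset.mem_insert_self v s) (hL _ h)
    · exact absurd h (singleton_ssubset_insert hn hv).ne'
    · rwa [Finset.erase_insert hv] at h
  · exact fun h => ⟨nonempty_of_mem h, hL _ h, insert_mem_attach (hL _ h) h⟩

theorem deletion_attach (hD : D.AvoidsVertex v) (hL : L.faces ⊆ D.faces) :
    (D.attach v L).deletion v = D := by
  ext s
  constructor
  · rintro ⟨h | h | h, hv⟩
    · exact h
    · exact hL h
    · exact absurd h.1 hv
  · exact fun h => ⟨.inl h, hD _ h⟩

theorem NonEvasive.attach (hD : D.NonEvasive) (hL : L.NonEvasive) (hv : D.AvoidsVertex v)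
    (hLD : L.faces ⊆ D.faces) : (D.attach v L).NonEvasive :=
  .step _ v apex_mem_attach (by rwa [link_attach hv (hv.mono hLD)]) (by rwa [deletion_attach hv hLD])

theorem AvoidsVertex.attach {w : V} (hD : D.AvoidsVertex w) (hL : L.faces ⊆ D.faces) (hw : w ≠ v) :
    (D.attach v L).AvoidsVertex w := by
  intro s hs
  rcases mem_attach_cases hL hs with h | rfl | ⟨t, ht, rfl⟩
  · exact hD _ h
  · simpa using hw
  · have := hD _ (hL ht)
    grind

theorem attach_mono {D' L' : PreAbstractSimplicialComplex V} (hD : D.faces ⊆ D'.faces)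
    (hL : L.faces ⊆ L'.faces) : (D.attach v L).faces ⊆ (D'.attach v L').faces := by
  rintro s (h | h | ⟨hv, h | h⟩)
  · exact .inl (hD h)
  · exact .inr (.inl (hL h))
  · exact .inr (.inr ⟨hv, .inl h⟩)
  · exact .inr (.inr ⟨hv, .inr (hL h)⟩)

/-- The cone with apex `v` over `L`. -/
abbrev cone (v : V) (L : PreAbstractSimplicialComplex V) : PreAbstractSimplicialComplex V :=
  L.attach v L

theorem nonmaxIn_cone (hK : K.AvoidsVertex v) : K.NonmaxIn (cone v K) := fun s hs =>
  ⟨insert v s, insert_mem_attach (hK s hs) hs, Finset.ssubset_insert (hK s hs)⟩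

theorem NonmaxIn.attach_nonmaxIn_cone (hL : L.NonmaxIn D) (hD : D.AvoidsVertex v)
    (hne : D.faces.Nonempty) : (D.attach v L).NonmaxIn (cone v D) := by
  intro s hs
  rcases mem_attach_cases hL.subset hs with h | rfl | ⟨t, ht, rfl⟩
  · exact nonmaxIn_cone hD s h
  · obtain ⟨t, ht⟩ := hne
    exact ⟨insert v t, insert_mem_attach (hD t ht) ht,
      singleton_ssubset_insert (nonempty_of_mem ht) (hD t ht)⟩
  · obtain ⟨u, hu, htu⟩ := hL t ht
    have hvu := hD u hu
    exact ⟨insert v u, insert_mem_attach hvu hu,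
      insert_ssubset_insert (fun h => hvu (htu.1 h)) hvu htu⟩

/-- For a vertex `w` of the base, both link and deletion of `w` in the cone are again cones with
apex `v`, with supports omitting `w`. The base may be any complex supported in `S`: links in it need
not be non-evasive and may be empty, in which case the cone is a point. -/
theorem nonEvasive_cone (S : Finset V) (hv : v ∉ S) :
    ∀ K : PreAbstractSimplicialComplex V, (∀ s ∈ K.faces, s ⊆ S) → (cone v K).NonEvasive := by
  induction S using Finset.induction_on with
  | empty =>
    intro K hK
    have hempty : ∀ s, s ∉ K.faces := fun s hs =>
      (nonempty_of_mem hs).ne_empty (Finset.subset_empty.1 (hK s hs))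
    refine .point _ v (Set.ext fun s => ⟨?_, ?_⟩)
    · rintro (h | h | ⟨-, h | h⟩)
      · exact absurd h (hempty _)
      · exact absurd h (hempty _)
      · exact h
      · exact absurd h (hempty _)
    · rintro rfl
      exact apex_mem_attach
  | insert w S hw ih =>
    intro K hK
    have hvw : v ≠ w := by grind
    have hvS : v ∉ S := by grind
    by_cases hwK : {w} ∈ K.faces
    · refine .step _ w (mem_attach_left hwK) ?_ ?_
      · have : (cone v K).link w = cone v (K.link w) := by
          ext s
          simp only [cone, attach, link, Set.mem_ofPred_eq]
          constructor
          · rintro ⟨hn, hws, h | h | ⟨hvs, h | h⟩⟩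
            · exact .inl ⟨hn, hws, h⟩
            · exact .inl ⟨hn, hws, h⟩
            · grind
            · by_cases hsv : s = {v}
              · grind
              · have e : (insert w s).erase v = insert w (s.erase v) := by grind
                have : (s.erase v).Nonempty := by
                  by_contra hc
                  rw [Finset.not_nonempty_iff_eq_empty] at hc
                  exact hsv (eq_singleton_of_erase_eq_empty (by grind) hc)
                rw [e] at h
                grind
          · rintro (⟨hn, hws, h⟩ | ⟨hn, hws, h⟩ | ⟨hvs, rfl | ⟨hn, hws, h⟩⟩)
            · exact ⟨hn, hws, .inl h⟩
            · exact ⟨hn, hws, .inl h⟩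
            · refine ⟨by simp, by grind, .inr (.inr ⟨by simp, .inr ?_⟩)⟩
              have e : (insert w {v} : Finset V).erase v = {w} := by grind
              rwa [e]
            · have e : (insert w s).erase v = insert w (s.erase v) := by grind
              refine ⟨⟨v, hvs⟩, by grind, .inr (.inr ⟨by grind, .inr ?_⟩)⟩
              rwa [e]
        rw [this]
        refine ih hvS _ fun s hs => ?_
        exact (Finset.subset_insert_iff_of_notMem hs.2.1).1
          ((Finset.subset_insert w s).trans (hK _ hs.2.2))
      · have : (cone v K).deletion w = cone v (K.deletion w) := by
          ext s
          simp only [cone, attach, deletion, Set.mem_ofPred_eq]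
          grind
        rw [this]
        refine ih hvS _ fun s hs => ?_
        have := hK _ hs.1
        have := hs.2
        grind
    · refine ih hvS K fun s hs => ?_
      have hws : w ∉ s := fun h => hwK (mem_of_subset hs (by simpa using h) (by simp))
      have := hK s hs
      grind

theorem NonEvasive.cone (hK : K.NonEvasive) (hv : K.AvoidsVertex v) : (cone v K).NonEvasive := by
  obtain ⟨S, hS⟩ := hK.exists_support
  refine nonEvasive_cone (S.erase v) (by simp) K fun s hs => ?_
  have := hS s hs
  have := hv s hs
  grind

end Attach

end PreAbstractSimplicialComplex

namespace PreAbstractSimplicialComplex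

/-! ### Complexes with two free faces and the inductive construction. -/

section Tower

variable {V : Type*} [DecidableEq V] {K L D E : PreAbstractSimplicialComplex V}
  {s t σ τ : Finset V} {v b : V} {d : ℕ}

/-- `K` is a non-evasive `d`-complex whose only free faces are the `(d - 1)`-dimensional faces
`σ` and `τ`, which share a face of codimension one. -/
structure HasTwoFreeFaces (d : ℕ) (K : PreAbstractSimplicialComplex V) (σ τ : Finset V) :
    Prop where
  hasDimension : K.HasDimension d
  nonEvasive : K.NonEvasive
  freeFaces_eq : K.freeFaces = {σ, τ}
  card_left : σ.card = d
  card_right : τ.card = d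
  card_inter : (σ ∩ τ).card + 1 = d

namespace HasTwoFreeFaces

theorem isFreeFace_left (h : HasTwoFreeFaces d K σ τ) : K.IsFreeFace σ := by
  have : σ ∈ K.freeFaces := by simp [h.freeFaces_eq]
  exact this

theorem isFreeFace_right (h : HasTwoFreeFaces d K σ τ) : K.IsFreeFace τ := by
  have : τ ∈ K.freeFaces := by simp [h.freeFaces_eq]
  exact this

theorem eq_or_eq (h : HasTwoFreeFaces d K σ τ) (hs : K.IsFreeFace s) : s = σ ∨ s = τ := by
  have : s ∈ K.freeFaces := hs
  simpa [h.freeFaces_eq] using this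

theorem ne (h : HasTwoFreeFaces d K σ τ) : σ ≠ τ := by
  rintro rfl
  have := h.card_inter
  rw [Finset.inter_self, h.card_left] at this
  omega

theorem faces_nonempty (h : HasTwoFreeFaces d K σ τ) : K.faces.Nonempty := ⟨σ, h.isFreeFace_left.1⟩

/-- The apex of an attached cone is not a free face, as it lies in several edges. -/
theorem not_isFreeFace_apex (h : HasTwoFreeFaces d L σ τ) (hv : L.AvoidsVertex v) :
    ¬ (D.attach v L).IsFreeFace {v} := by
  intro hf
  have hσ := h.isFreeFace_left.1
  have hτ := h.isFreeFace_right.1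
  refine h.ne (insert_inj_of_notMem (hv _ hσ) (hv _ hτ) (hf.eq_of_ssubset
    (insert_mem_attach (hv _ hσ) hσ) (singleton_ssubset_insert (nonempty_of_mem hσ) (hv _ hσ))
    (insert_mem_attach (hv _ hτ) hτ) (singleton_ssubset_insert (nonempty_of_mem hτ) (hv _ hτ))))

/-- Attaching a cone over `L` to `D` removes the free faces of `D` lying in `L`, and creates only
the cones over the free faces of `L`. -/
theorem attach (hL : HasTwoFreeFaces d L σ τ) (hdim : D.HasDimension (d + 1))
    (hD : D.NonEvasive) (hv : D.AvoidsVertex v) (hfree : D.freeFaces ⊆ L.faces)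
    (hLD : L.NonmaxIn D) :
    HasTwoFreeFaces (d + 1) (D.attach v L) (insert v σ) (insert v τ) := by
  have hvL : L.AvoidsVertex v := hv.mono hLD.subset
  have hσ := hL.isFreeFace_left
  have hτ := hL.isFreeFace_right
  have hvσ := hvL _ hσ.1
  have hvτ := hvL _ hτ.1
  have hlink : ∀ s, s.Nonempty → v ∉ s →
      ((D.attach v L).IsFreeFace (insert v s) ↔ L.IsFreeFace s) := fun s hs hvs => by
    rw [isFreeFace_insert_iff hs hvs, link_attach hv hvL]
  refine ⟨⟨?_, ?_⟩, hD.attach hL.nonEvasive hv hLD.subset, ?_, ?_, ?_, ?_⟩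
  · obtain ⟨⟨s, hs, hc⟩, -⟩ := hdim
    exact ⟨s, mem_attach_left hs, hc⟩
  · intro s hs
    rcases mem_attach_cases hLD.subset hs with h | rfl | ⟨t, ht, rfl⟩
    · exact hdim.2 s h
    · simp
    · have := hL.hasDimension.2 t ht
      rw [Finset.card_insert_of_notMem (hvL t ht)]
      omega
  · ext s
    constructor
    · intro hs
      rcases mem_attach_cases hLD.subset hs.1 with h | rfl | ⟨t, ht, rfl⟩
      · exfalso
        have hvs := hv _ h
        -- A face of `L` has two cofaces, one in `D` and one through `v`.
        have hsL : s ∉ L.faces := fun hsL => by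
          obtain ⟨t, ht, hst⟩ := hLD s hsL
          have := hs.eq_of_ssubset (mem_attach_left ht) hst (insert_mem_attach hvs hsL)
            (Finset.ssubset_insert hvs)
          exact hv _ ht (this ▸ Finset.mem_insert_self v s)
        -- Outside `L`, attaching the cone adds no cofaces, so `s` would already be free in `D` and
        -- hence lie in `L`.
        have hup : ∀ u ∈ (D.attach v L).faces, s ⊂ u → u ∈ D.faces := fun u hu hsu => by
          rcases mem_attach_cases hLD.subset hu with hu | rfl | ⟨t, ht, rfl⟩
          · exact hu
          · exact absurd ((Finset.ssubset_singleton_iff.1 hsu)) (nonempty_of_mem h).ne_empty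
          · exact absurd (mem_of_subset ht ((Finset.subset_insert_iff_of_notMem hvs).1 hsu.1)
              (nonempty_of_mem h)) hsL
        obtain ⟨-, u, ⟨hu, hsu⟩, huu⟩ := hs
        exact hsL (hfree ⟨h, u, ⟨hup u hu hsu, hsu⟩,
          fun w hw => huu w ⟨mem_attach_left hw.1, hw.2⟩⟩)
      · exact absurd hs (hL.not_isFreeFace_apex hvL)
      · rcases hL.eq_or_eq ((hlink t (nonempty_of_mem ht) (hvL t ht)).1 hs) with rfl | rfl <;> simp
    · rintro (rfl | rfl)
      · exact (hlink σ (nonempty_of_mem hσ.1) hvσ).2 hσ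
      · exact (hlink τ (nonempty_of_mem hτ.1) hvτ).2 hτ
  · rw [Finset.card_insert_of_notMem hvσ, hL.card_left]
  · rw [Finset.card_insert_of_notMem hvτ, hL.card_right]
  · rw [← Finset.insert_inter_distrib, Finset.card_insert_of_notMem (by grind), hL.card_inter]

theorem hasDimension_cone (h : HasTwoFreeFaces d K σ τ) (hv : K.AvoidsVertex v) :
    (cone v K).HasDimension (d + 1) := by
  obtain ⟨⟨s, hs, hc⟩, hle⟩ := h.hasDimension
  refine ⟨⟨insert v s, insert_mem_attach (hv s hs) hs, ?_⟩, fun t ht => ?_⟩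
  · rw [Finset.card_insert_of_notMem (hv s hs), hc]
  · rcases mem_attach_cases subset_rfl ht with h | rfl | ⟨u, hu, rfl⟩
    · exact (hle t h).trans (by omega)
    · simp
    · rw [Finset.card_insert_of_notMem (hv u hu)]
      exact Nat.succ_le_succ (hle u hu)

theorem freeFaces_cone (h : HasTwoFreeFaces d K σ τ) (hv : K.AvoidsVertex v)
    (hs : (cone v K).IsFreeFace s) : s ∈ K.faces ∨ s = insert v σ ∨ s = insert v τ := by
  rcases mem_attach_cases subset_rfl hs.1 with hK | rfl | ⟨t, ht, rfl⟩
  · exact .inl hK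
  · exact absurd hs (h.not_isFreeFace_apex hv)
  · rw [isFreeFace_insert_iff (nonempty_of_mem ht) (hv t ht), link_attach hv hv] at hs
    rcases h.eq_or_eq hs with rfl | rfl <;> simp

end HasTwoFreeFaces

/-- A complex with two free faces `σ` and `τ` as in `HasTwoFreeFaces`, together with a subcomplex
of the same type in dimension one less which contains `σ` and `τ`, but no maximal face; this
subcomplex again has such a subcomplex, and so on down to dimension one. -/
inductive FreeFaceTower : ℕ → PreAbstractSimplicialComplex V → Finset V → Finset V → Prop
  | one {K : PreAbstractSimplicialComplex V} {σ τ : Finset V} (hK : HasTwoFreeFaces 1 K σ τ) :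
    FreeFaceTower 1 K σ τ
  | succ {d : ℕ} {K G : PreAbstractSimplicialComplex V} {σ τ γ δ : Finset V}
    (hK : HasTwoFreeFaces (d + 1) K σ τ) (hG : FreeFaceTower d G γ δ) (hGK : G.NonmaxIn K)
    (hσ : σ ∈ G.faces) (hτ : τ ∈ G.faces) : FreeFaceTower (d + 1) K σ τ

theorem FreeFaceTower.hasTwoFreeFaces (h : FreeFaceTower d K σ τ) : HasTwoFreeFaces d K σ τ := by
  cases h <;> assumption

/-- The complex with vertices `x` and `y` and no edges. -/
def twoPoints (x y : V) : PreAbstractSimplicialComplex V where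
  faces := {{x}, {y}}
  isRelLowerSet_faces := by
    rintro s (rfl | rfl) <;> exact ⟨by simp, fun t hts ht => by
      simp [(Finset.subset_singleton_iff.1 hts).resolve_left ht.ne_empty]⟩

/-- The path with vertices `x`, `b` and `y`. -/
abbrev path (x b y : V) : PreAbstractSimplicialComplex V := cone b (twoPoints x y)

theorem mem_path_iff {x y : V} (hbx : b ≠ x) (hby : b ≠ y) :
    s ∈ (path x b y).faces ↔ s = {x} ∨ s = {y} ∨ s = {b} ∨ s = {b, x} ∨ s = {b, y} := by
  constructor
  · intro hs
    rcases mem_attach_cases subset_rfl hs with (rfl | rfl) | rfl | ⟨t, rfl | rfl, rfl⟩ <;> simp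
  · rintro (rfl | rfl | rfl | rfl | rfl)
    · exact mem_attach_left (.inl rfl)
    · exact mem_attach_left (.inr rfl)
    · exact apex_mem_attach
    · exact insert_mem_attach (by simpa using hbx) (.inl rfl)
    · exact insert_mem_attach (by simpa using hby) (.inr rfl)

theorem hasTwoFreeFaces_path {x y : V} (hbx : b ≠ x) (hby : b ≠ y) (hxy : x ≠ y) :
    HasTwoFreeFaces 1 (path x b y) {x} {y} := by
  have hmem : ∀ s, s ∈ (path x b y).faces ↔ s = {x} ∨ s = {y} ∨ s = {b} ∨ s = {b, x} ∨ s = {b, y} :=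
    fun s => mem_path_iff hbx hby
  have hne : ({b, x} : Finset V) ≠ {b, y} := fun h =>
    hxy (Finset.singleton_inj.1 (insert_inj_of_notMem (by simpa) (by simpa) h))
  have hmax : ∀ z ∈ ({x, y} : Set V), ¬ (path x b y).IsFreeFace {b, z} := by
    rintro z hz ⟨-, t, ⟨ht, hzt⟩, -⟩
    have h2 : ({b, z} : Finset V).card = 2 := Finset.card_pair (by
      rcases hz with rfl | rfl <;> assumption)
    have := Finset.card_lt_card hzt
    have : t.card ≤ 2 := by
      rcases (hmem t).1 ht with rfl | rfl | rfl | rfl | rfl <;> simp [Finset.card_le_two]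
    omega
  have hleaf : ∀ z ∈ ({x, y} : Set V), (path x b y).IsFreeFace {z} := by
    intro z hz
    have hbz : b ≠ z := by rcases hz with rfl | rfl <;> assumption
    refine ⟨(hmem _).2 (by rcases hz with rfl | rfl <;> simp), {b, z},
      ⟨(hmem _).2 (by rcases hz with rfl | rfl <;> simp), Finset.ssubset_insert (by simpa)⟩, ?_⟩
    rintro t ⟨ht, hzt⟩
    have hzt' : z ∈ t := hzt.1 (by simp)
    have := hzt.ne
    rcases hz with rfl | rfl <;> rcases (hmem t).1 ht with rfl | rfl | rfl | rfl | rfl <;> grind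
  refine ⟨⟨⟨{b, x}, (hmem _).2 (by simp), Finset.card_pair hbx⟩, fun s hs => ?_⟩,
    nonEvasive_cone {x, y} (by simp [hbx, hby]) _ (by rintro s (rfl | rfl) <;> simp), ?_,
    by simp, by simp, by simp [hxy]⟩
  · rcases (hmem s).1 hs with rfl | rfl | rfl | rfl | rfl <;> simp [Finset.card_le_two]
  · ext s
    constructor
    · intro hs
      rcases (hmem s).1 hs.1 with rfl | rfl | rfl | rfl | rfl
      · simp
      · simp
      · refine absurd (hs.eq_of_ssubset ((hmem {b, x}).2 (by simp)) ?_
          ((hmem {b, y}).2 (by simp)) ?_) hne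
        · exact singleton_ssubset_insert (by simp) (by simpa)
        · exact singleton_ssubset_insert (by simp) (by simpa)
      · exact absurd hs (hmax x (by simp))
      · exact absurd hs (hmax y (by simp))
    · rintro (rfl | rfl)
      · exact hleaf x (by simp)
      · exact hleaf y (by simp)

/-- The path from `x` through `b` to `y` serves. Its edges are not maximal in the cone because `{x}`
and `{y}`, being free, have proper cofaces in `K`, and these can be coned off too. -/
theorem HasTwoFreeFaces.exists_path (h : HasTwoFreeFaces 1 K σ τ) (hb : K.AvoidsVertex b) :
    ∃ G, HasTwoFreeFaces 1 G σ τ ∧ insert b σ ∈ G.faces ∧ insert b τ ∈ G.faces ∧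
      G.NonmaxIn (cone b K) := by
  obtain ⟨x, rfl⟩ := Finset.card_eq_one.1 h.card_left
  obtain ⟨y, rfl⟩ := Finset.card_eq_one.1 h.card_right
  have hx := h.isFreeFace_left
  have hy := h.isFreeFace_right
  have hbx : b ≠ x := by simpa using hb _ hx.1
  have hby : b ≠ y := by simpa using hb _ hy.1
  refine ⟨path x b y, hasTwoFreeFaces_path hbx hby fun hxy => h.ne (by rw [hxy]),
    (mem_path_iff hbx hby).2 (by simp), (mem_path_iff hbx hby).2 (by simp), fun s hs => ?_⟩
  have key : ∀ z, K.IsFreeFace {z} → ∃ t ∈ (cone b K).faces, insert b {z} ⊂ t := fun z hz => by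
    obtain ⟨hzK, t, ⟨ht, hzt⟩, -⟩ := hz
    exact ⟨insert b t, insert_mem_attach (hb t ht) ht,
      insert_ssubset_insert (hb _ hzK) (hb t ht) hzt⟩
  rcases (mem_path_iff hbx hby).1 hs with rfl | rfl | rfl | rfl | rfl
  · exact nonmaxIn_cone hb _ hx.1
  · exact nonmaxIn_cone hb _ hy.1
  · exact ⟨_, insert_mem_attach (hb _ hx.1) hx.1, singleton_ssubset_insert (by simp) (hb _ hx.1)⟩
  · exact key x hx
  · exact key y hy

theorem HasTwoFreeFaces.attach_tower {G : PreAbstractSimplicialComplex V} {γ δ : Finset V}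
    (h : HasTwoFreeFaces (d + 1) E σ τ) (hG : HasTwoFreeFaces d G γ δ) (hGE : G.NonmaxIn E)
    (hσ : σ ∈ G.faces) (hτ : τ ∈ G.faces) (hb : E.AvoidsVertex b) :
    HasTwoFreeFaces (d + 1) (E.attach b G) (insert b γ) (insert b δ) :=
  hG.attach h.hasDimension h.nonEvasive hb
    (by rw [h.freeFaces_eq]; rintro s (rfl | rfl) <;> assumption) hGE

/-- A cone over a tower contains a tower of the same dimension through the cones over the two free
faces. -/
theorem FreeFaceTower.exists_in_cone (h : FreeFaceTower d K σ τ) (hb : K.AvoidsVertex b) :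
    ∃ G γ δ, FreeFaceTower d G γ δ ∧ insert b σ ∈ G.faces ∧ insert b τ ∈ G.faces ∧
      G.NonmaxIn (cone b K) := by
  induction h with
  | one hK =>
    obtain ⟨G, hG, h1, h2, h3⟩ := hK.exists_path hb
    exact ⟨G, _, _, .one hG, h1, h2, h3⟩
  | @succ d K G σ τ γ δ hK hG hGK hσ hτ ih =>
    have hbG := hb.mono hGK.subset
    -- The required complex is `K ∪ b * G`: it contains `b * σ` and `b * τ` because `σ` and `τ` are
    -- in `G`. Its own free faces are `b * γ` and `b * δ`, and the induction hypothesis gives the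
    -- tower through them inside `b * G`.
    obtain ⟨H, α, β, hH, h1, h2, h3⟩ := ih hbG
    exact ⟨K.attach b G, _, _,
      .succ (hK.attach_tower hG.hasTwoFreeFaces hGK hσ hτ hb) hH
        (h3.mono (attach_mono hGK.subset subset_rfl)) h1 h2,
      insert_mem_attach (hb _ hK.isFreeFace_left.1) hσ,
      insert_mem_attach (hb _ hK.isFreeFace_right.1) hτ,
      hGK.attach_nonmaxIn_cone hb hK.faces_nonempty⟩

/-- The dimension starts at two because a tower of dimension one carries no subcomplex `G` to cone
off. -/
theorem FreeFaceTower.exists_succ [Infinite V] (h : FreeFaceTower (d + 2) E σ τ) :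
    ∃ (K : PreAbstractSimplicialComplex V) (σ' τ' : Finset V), FreeFaceTower (d + 3) K σ' τ' := by
  obtain ⟨S, hS⟩ := h.hasTwoFreeFaces.nonEvasive.exists_support
  obtain ⟨b, hbS⟩ := Infinite.exists_notMem_finset S
  obtain ⟨a, haS⟩ := Infinite.exists_notMem_finset (insert b S)
  have hb : E.AvoidsVertex b := fun s hs h => hbS (hS s hs h)
  have ha : E.AvoidsVertex a := fun s hs h => haS (Finset.mem_insert_of_mem (hS s hs h))
  have hab : a ≠ b := fun h => haS (by simp [h])
  obtain _ | @⟨_, _, G, _, _, γ, δ, hE, hG, hGE, hσ, hτ⟩ := h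
  have hbG := hb.mono hGE.subset
  obtain ⟨H, α, β, hH, h1, h2, h3⟩ := hG.exists_in_cone hbG
  -- `F = E ∪ b * G` has the dimension of `E`, and `H` makes it a tower in its own right.
  have hF := hE.attach_tower hG.hasTwoFreeFaces hGE hσ hτ hb
  have hF' : FreeFaceTower (d + 2) (E.attach b G) (insert b γ) (insert b δ) :=
    .succ hF hH (h3.mono (attach_mono hGE.subset subset_rfl)) h1 h2
  have haF : (E.attach b G).AvoidsVertex a := ha.attach hGE.subset hab
  have hFE := hGE.attach_nonmaxIn_cone hb hE.faces_nonempty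
  obtain ⟨H', α', β', hH', h1', h2', h3'⟩ := hF'.exists_in_cone haF
  refine ⟨(cone b E).attach a (E.attach b G), _, _,
    .succ (hF.attach (hE.hasDimension_cone hb) (hE.nonEvasive.cone hb)
      (ha.attach subset_rfl hab) (fun s hs => ?_) hFE) hH'
      (h3'.mono (attach_mono hFE.subset subset_rfl)) h1' h2'⟩
  -- Every free face of `b * E` must lie in `F`, so that the cone over `F` removes it.
  rcases hE.freeFaces_cone hb hs with h | rfl | rfl
  · exact mem_attach_left h
  · exact insert_mem_attach (hb _ hE.isFreeFace_left.1) hσ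
  · exact insert_mem_attach (hb _ hE.isFreeFace_right.1) hτ

end Tower

/-! ### Passing to a finite vertex type. -/

section Pullback

variable {V W : Type*}

/-- The complex of all finite sets whose image under `f` is a face of `K`. -/
def pullback (f : W ↪ V) (K : PreAbstractSimplicialComplex V) : PreAbstractSimplicialComplex W where
  faces := {s | s.map f ∈ K.faces}
  isRelLowerSet_faces := fun _ hs => ⟨by simpa using nonempty_of_mem hs, fun _ hts ht =>
    mem_of_subset hs (Finset.map_subset_map.2 hts) (by simpa using ht)⟩

variable {f : W ↪ V} {K : PreAbstractSimplicialComplex V}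

theorem pullback_link [DecidableEq V] [DecidableEq W] (w : W) :
    (pullback f K).link w = pullback f (K.link (f w)) := by
  ext s
  simp [pullback, link]

theorem pullback_deletion (w : W) : (pullback f K).deletion w = pullback f (K.deletion (f w)) := by
  ext s
  simp [pullback, deletion]

variable [DecidableEq V] [DecidableEq W]

/-- Since every face is an image under `f`, the vertices chosen in the derivation lift to `W`, and
pullback commutes with their links and deletions. -/
theorem NonEvasive.pullback (h : K.NonEvasive)
    (hf : ∀ s ∈ K.faces, ∃ t : Finset W, t.map f = s) : (pullback f K).NonEvasive := by
  induction h with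
  | point K v hK =>
    obtain ⟨t, ht⟩ := hf {v} (by simp [hK])
    obtain ⟨w, rfl⟩ : ∃ w, t = {w} := by
      rw [← Finset.card_eq_one, ← Finset.card_map f, ht, Finset.card_singleton]
    refine .point _ w (Set.ext fun s => ?_)
    have : s.map f = {v} ↔ s = {w} := by rw [← ht, Finset.map_inj]
    simpa [PreAbstractSimplicialComplex.pullback, hK] using this
  | step K v hv _ _ ihl ihd =>
    obtain ⟨t, ht⟩ := hf {v} hv
    obtain ⟨w, rfl⟩ : ∃ w, t = {w} := by
      rw [← Finset.card_eq_one, ← Finset.card_map f, ht, Finset.card_singleton]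
    obtain rfl : f w = v := by simpa using ht
    refine .step _ w (by simpa [PreAbstractSimplicialComplex.pullback] using hv) ?_ ?_
    · rw [pullback_link]
      refine ihl fun s hs => ?_
      obtain ⟨t, ht⟩ := hf _ hs.2.2
      exact Finset.subset_map_iff.1 (ht ▸ Finset.subset_insert _ _) |>.imp fun _ h => h.2.symm
    · rw [pullback_deletion]
      exact ihd fun s hs => hf s hs.1

theorem HasTwoFreeFaces.pullback {d : ℕ} {σ τ : Finset V} (h : HasTwoFreeFaces d K σ τ)
    (hf : ∀ s ∈ K.faces, ∃ t : Finset W, t.map f = s) :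
    ∃ σ' τ', HasTwoFreeFaces d (pullback f K) σ' τ' := by
  obtain ⟨σ', rfl⟩ := hf _ h.isFreeFace_left.1
  obtain ⟨τ', rfl⟩ := hf _ h.isFreeFace_right.1
  refine ⟨σ', τ', ⟨?_, ?_⟩, h.nonEvasive.pullback hf, ?_, ?_, ?_, ?_⟩
  · obtain ⟨s, hs, hc⟩ := h.hasDimension.1
    obtain ⟨t, rfl⟩ := hf s hs
    exact ⟨t, hs, by simpa using hc⟩
  · intro s hs
    simpa using h.hasDimension.2 _ hs
  · have key : ∀ s, (PreAbstractSimplicialComplex.pullback f K).IsFreeFace s ↔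
        K.IsFreeFace (s.map f) := fun s => by
      refine and_congr Iff.rfl ⟨?_, ?_⟩
      · rintro ⟨t, ⟨ht, hst⟩, hu⟩
        refine ⟨t.map f, ⟨ht, Finset.map_ssubset_map.2 hst⟩, ?_⟩
        rintro u ⟨huK, hsu⟩
        obtain ⟨u, rfl⟩ := hf u huK
        rw [hu u ⟨huK, Finset.map_ssubset_map.1 hsu⟩]
      · rintro ⟨t, ⟨ht, hst⟩, hu⟩
        obtain ⟨t, rfl⟩ := hf t ht
        exact ⟨t, ⟨ht, Finset.map_ssubset_map.1 hst⟩, fun u ⟨huK, hsu⟩ =>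
          Finset.map_injective f (hu _ ⟨huK, Finset.map_ssubset_map.2 hsu⟩)⟩
    ext s
    have : s.map f ∈ K.freeFaces ↔ s.map f = σ'.map f ∨ s.map f = τ'.map f := by
      rw [h.freeFaces_eq]; rfl
    rw [Finset.map_inj, Finset.map_inj] at this
    exact (key s).trans this
  · simpa using h.card_left
  · simpa using h.card_right
  · simpa [← Finset.map_inter] using h.card_inter

end Pullback

end PreAbstractSimplicialComplex

namespace PreAbstractSimplicialComplex

/-! ### The two-dimensional starting complex, verified by computation. -/

section Checker

/-- The link of `v` in a complex given by the list of its faces. -/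
def linkList (v : ℕ) (F : List (List ℕ)) : List (List ℕ) :=
  ((F.filter fun s => s.contains v).map fun s => s.filter fun x => !(x == v)).filter
    fun s => !s.isEmpty

theorem mem_linkList_iff {v : ℕ} {F : List (List ℕ)} {s : Finset ℕ} :
    (∃ l ∈ linkList v F, l.toFinset = s) ↔
      ∃ l ∈ F, v ∈ l ∧ l.toFinset.erase v = s ∧ s.Nonempty := by
  have key : ∀ l : List ℕ, (l.filter fun x => !(x == v)).toFinset = l.toFinset.erase v := fun l => by
    ext x
    simp [and_comm]
  have hne : ∀ l : List ℕ, (!l.isEmpty) = true ↔ l.toFinset.Nonempty := fun l => by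
    simp
  constructor
  · rintro ⟨l, hl, rfl⟩
    simp only [linkList, List.mem_filter, List.mem_map, List.contains_iff_mem, hne] at hl
    obtain ⟨⟨l, ⟨hl, hv⟩, rfl⟩, hn⟩ := hl
    exact ⟨l, hl, hv, (key l).symm, hn⟩
  · rintro ⟨l, hl, hv, rfl, hn⟩
    refine ⟨l.filter fun x => !(x == v), ?_, key l⟩
    simp only [linkList, List.mem_filter, List.mem_map, List.contains_iff_mem, hne]
    exact ⟨⟨l, ⟨hl, hv⟩, rfl⟩, by rwa [key]⟩

/-- The deletion of `v` in a complex given by the list of its faces. -/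
def deletionList (v : ℕ) (F : List (List ℕ)) : List (List ℕ) := F.filter fun s => !s.contains v

/-- A search, to recursion depth `n`, for a proof that a complex given by the list of its faces is
non-evasive. -/
def checkNonEvasive : ℕ → List (List ℕ) → Bool
  | 0, _ => false
  | n + 1, F => F.flatten.any fun v => F == [[v]] ||
      F.contains [v] && checkNonEvasive n (linkList v F) && checkNonEvasive n (deletionList v F)

/-- Only soundness is needed: comparing lists rather than sets of faces can make the search fail,
but never succeed wrongly. -/
theorem nonEvasive_of_checkNonEvasive (n : ℕ) : ∀ (F : List (List ℕ))
    (K : PreAbstractSimplicialComplex ℕ), (∀ s, s ∈ K.faces ↔ ∃ l ∈ F, l.toFinset = s) →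
    checkNonEvasive n F = true → K.NonEvasive := by
  induction n with
  | zero => simp [checkNonEvasive]
  | succ n ih =>
    intro F K hK h
    simp only [checkNonEvasive, List.any_eq_true, Bool.or_eq_true, Bool.and_eq_true,
      List.contains_iff_mem, beq_iff_eq] at h
    obtain ⟨v, -, rfl | ⟨⟨hv, hl⟩, hd⟩⟩ := h
    · exact .point K v (Set.ext fun s => by rw [hK]; simp [eq_comm])
    · refine .step K v ((hK _).2 ⟨_, hv, by simp⟩) (ih _ _ (fun s => ?_) hl)
        (ih _ _ (fun s => ?_) hd)
      · rw [mem_linkList_iff]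
        constructor
        · rintro ⟨hn, hvs, hs⟩
          obtain ⟨l, hl, hls⟩ := (hK _).1 hs
          exact ⟨l, hl, by rw [← List.mem_toFinset, hls]; simp,
            by rw [hls, Finset.erase_insert hvs], hn⟩
        · rintro ⟨l, hl, hvl, rfl, hn⟩
          exact ⟨hn, by simp, (hK _).2 ⟨l, hl, by
            rw [Finset.insert_erase (List.mem_toFinset.2 hvl)]⟩⟩
      · have : s ∈ (K.deletion v).faces ↔ s ∈ K.faces ∧ v ∉ s := Iff.rfl
        rw [this, hK]
        constructor
        · rintro ⟨⟨l, hl, rfl⟩, hvl⟩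
          exact ⟨l, by simpa [deletionList, hl] using hvl, rfl⟩
        · rintro ⟨l, hl, rfl⟩
          simp only [deletionList, List.mem_filter] at hl
          exact ⟨⟨l, hl.1, rfl⟩, by simpa using hl.2⟩

/-- The faces of a non-evasive 2-complex with 9 triangles, in which only the edges `{0, 5}` and
`{2, 5}` are free. -/
def twoComplexList : List (List ℕ) :=
  [[5], [0], [3], [4], [1], [2],
   [0, 5], [3, 5], [4, 5], [1, 5], [2, 5], [0, 1], [0, 2], [0, 3], [0, 4], [1, 2], [1, 4], [2, 3],
   [2, 4], [3, 4],
   [0, 1, 2], [0, 1, 4], [0, 2, 3], [0, 2, 4], [0, 3, 5], [1, 2, 5], [1, 4, 5], [2, 3, 4],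
   [3, 4, 5]]

/-- The faces in `twoComplexList` as a finite set. -/
def twoComplexFaces : Finset (Finset ℕ) := (twoComplexList.map List.toFinset).toFinset

/-- The complex with faces `twoComplexFaces`. -/
def twoComplex : PreAbstractSimplicialComplex ℕ where
  faces := twoComplexFaces
  isRelLowerSet_faces := by
    have h : ∀ s ∈ twoComplexFaces, s.Nonempty ∧
        ∀ t ∈ s.powerset, t.Nonempty → t ∈ twoComplexFaces := by decide +kernel
    exact fun s hs => ⟨(h s hs).1, fun t hts ht => (h s hs).2 t (Finset.mem_powerset.2 hts) ht⟩

theorem mem_twoComplex {s : Finset ℕ} : s ∈ twoComplex.faces ↔ s ∈ twoComplexFaces := Iff.rfl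

theorem hasTwoFreeFaces_twoComplex : HasTwoFreeFaces 2 twoComplex {0, 5} {2, 5} := by
  have hcard : ∀ s ∈ twoComplexFaces, s.card ≤ 3 := by decide +kernel
  have hfree : ∀ s ∈ twoComplexFaces,
      (twoComplexFaces.filter (s ⊂ ·)).card = 1 ↔ s = {0, 5} ∨ s = {2, 5} := by decide +kernel
  refine ⟨⟨⟨{0, 1, 2}, mem_twoComplex.2 (by decide +kernel), by simp⟩, hcard⟩,
    -- Depth six suffices, as there are six vertices and each link or deletion loses at least one.
    -- The link of 5 is the path 0, 3, 4, 1, 2.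
    nonEvasive_of_checkNonEvasive 6 twoComplexList _ (fun s => ?_) (by decide +kernel), ?_,
    by simp, by simp, by decide⟩
  · simp [mem_twoComplex, twoComplexFaces]
  · ext s
    -- Unique existence over all finite sets of naturals becomes a count over a finite list of
    -- faces, which can be decided.
    have key : (∃! t, t ∈ twoComplexFaces ∧ s ⊂ t) ↔
        (twoComplexFaces.filter (s ⊂ ·)).card = 1 := by
      rw [Finset.card_eq_one]
      refine exists_congr fun t => ⟨fun h => ?_, fun h => ?_⟩
      · ext u
        rw [Finset.mem_filter, Finset.mem_singleton]
        exact ⟨h.2 u, by rintro rfl; exact h.1⟩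
      · have hu : ∀ u, u ∈ twoComplexFaces ∧ s ⊂ u ↔ u = t := fun u => by
          rw [← Finset.mem_filter, h, Finset.mem_singleton]
        exact ⟨(hu t).2 rfl, fun u => (hu u).1⟩
    constructor
    · exact fun hs => (hfree s hs.1).1 (key.1 hs.2)
    · intro hs
      have hmem : s ∈ twoComplexFaces := by rcases hs with rfl | rfl <;> decide +kernel
      exact ⟨hmem, key.2 ((hfree s hmem).2 hs)⟩

/-- The two free edges form the path 0, 5, 2, and each lies in a triangle, so this path is the lower
stage of the tower. -/
theorem freeFaceTower_twoComplex : FreeFaceTower 2 twoComplex {0, 5} {2, 5} := by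
  refine .succ hasTwoFreeFaces_twoComplex
    (.one (hasTwoFreeFaces_path (x := 0) (b := 5) (y := 2) (by simp) (by simp) (by simp)))
    (fun s hs => ?_) ((mem_path_iff (by simp) (by simp)).2 (by simp [Finset.pair_comm]))
    ((mem_path_iff (by simp) (by simp)).2 (by simp [Finset.pair_comm]))
  have h : ∀ s ∈ ({{0}, {2}, {5}, {5, 0}, {5, 2}} : Finset (Finset ℕ)),
      ∃ t ∈ twoComplexFaces, s ⊂ t := by decide +kernel
  exact h s (by simpa using (mem_path_iff (by simp) (by simp)).1 hs)

end Checker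

/-! ### Existence in every dimension. -/

theorem exists_freeFaceTower (d : ℕ) :
    ∃ (K : PreAbstractSimplicialComplex ℕ) (σ τ : Finset ℕ), FreeFaceTower (d + 2) K σ τ := by
  induction d with
  | zero => exact ⟨_, _, _, freeFaceTower_twoComplex⟩
  | succ d ih =>
    obtain ⟨K, σ, τ, h⟩ := ih
    exact h.exists_succ

theorem exists_hasTwoFreeFaces {d : ℕ} (hd : 1 ≤ d) :
    ∃ (K : PreAbstractSimplicialComplex ℕ) (σ τ : Finset ℕ), HasTwoFreeFaces d K σ τ := by
  obtain _ | _ | d := d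
  · omega
  · exact ⟨_, _, _, hasTwoFreeFaces_path (x := 0) (b := 1) (y := 2) (by simp) (by simp) (by simp)⟩
  · obtain ⟨K, σ, τ, h⟩ := exists_freeFaceTower d
    exact ⟨K, σ, τ, h.hasTwoFreeFaces⟩

theorem exists_fintype_hasTwoFreeFaces {d : ℕ} (hd : 1 ≤ d) :
    ∃ (V : Type) (_ : Fintype V) (_ : DecidableEq V) (K : PreAbstractSimplicialComplex V)
      (σ τ : Finset V), HasTwoFreeFaces d K σ τ := by
  obtain ⟨K, σ, τ, h⟩ := exists_hasTwoFreeFaces hd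
  obtain ⟨S, hS⟩ := h.nonEvasive.exists_support
  obtain ⟨σ', τ', h'⟩ := h.pullback (f := Function.Embedding.subtype (· ∈ S)) fun s hs =>
    ⟨s.subtype (· ∈ S), Finset.subtype_map_of_mem fun x hx => hS s hs hx⟩
  exact ⟨S, inferInstance, inferInstance, _, σ', τ', h'⟩

end PreAbstractSimplicialComplex

theorem theorem2p4 (d : ℕ) (hd : 1 ≤ d) :
    (∃ (V : Type) (_ : Fintype V) (_ : DecidableEq V) (E : PreAbstractSimplicialComplex V),
      E.HasDimension d ∧ E.NonEvasive ∧
        ∃ σ τ : Finset V, σ ≠ τ ∧ E.freeFaces = {σ, τ} ∧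
          σ.card = d ∧ τ.card = d ∧ (σ ∩ τ).card + 1 = d) ∧
    (∀ (W : Type*) [DecidableEq W] (K : PreAbstractSimplicialComplex W),
      K.HasDimension d → K.NonEvasive → 2 ≤ K.freeFaces.encard) := by
  refine ⟨?_, fun W _ K hK h => h.two_le_encard_freeFaces hd hK⟩
  obtain ⟨V, hV, hV', E, σ, τ, h⟩ :=
    PreAbstractSimplicialComplex.exists_fintype_hasTwoFreeFaces hd
  exact ⟨V, hV, hV', E, h.hasDimension, h.nonEvasive, σ, τ, h.ne, h.freeFaces_eq, h.card_left,
    h.card_right, h.card_inter⟩
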